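/- Let $f\in C(\mathbb{R};\mathbb{R})$ be locally Lipschitz continuous with $yf(y)>0$ for all $y\neq 0$ and $f(0)=0$. Put $F(y)=\int_y^1 \frac{du}{f(u)}$ for $y>0$, suppose that $F(y)\to+\infty$ as $y\to 0^+$, and let $F^{-1}$ denote the inverse of the strictly decreasing function $F$ on $(0,\infty)$. Let $g\in C([0,\infty);\mathbb{R})$ with $g(t)>0$ for all $t>0$, and let $\xi>0$. Suppose that $f$ is regularly varying at $0$ with index $\beta>1$, that is, $\lim_{y\to 0^+} f(\lambda y)/f(y)=\lambda^{\beta}$ for every $\lambda>0$, and that $g$ is regularly varying at infinity with index $-\theta$ for some $\theta\geq 0$, that is, $\lim_{t\to\infty} g(\lambda t)/g(t)=\lambda^{-\theta}$ for every $\lambda>0$. Suppose further that $$\lim_{t\to\infty}\frac{g(t)}{f(F^{-1}(t))}=+\infty .$$ Let $x$ be the unique continuous solution on $[0,\infty)$ of $$x'(t)=-f(x(t))+g(t),\quad t>0;\qquad x(0)=\xi,$$ and suppose that $x(t)\to 0$ as $t\to\infty$. (i) If $\theta>0$, then $$\lim_{t\to\infty}\frac{f(x(t))}{g(t)}=1 .$$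 (ii) If $\theta=0$ and $g$ is asymptotic to a decreasing function (that is, there is a function $\gamma$, non-increasing on $(0,\infty)$, with $g(t)/\gamma(t)\to 1$ as $t\to\infty$), then likewise $\lim_{t\to\infty} f(x(t))/g(t)=1$. -/

import Mathlib

open Set Filter Topology

namespace PerturbedODE

/-- `f ∈ RV₀(β)`: `f` is measurable and positive on `(0, ∞)`, and
`f (λ x) / f x → λ ^ β` as `x → 0⁺` for every `λ > 0`. -/
structure RegVaryZero (f : ℝ → ℝ) (β : ℝ) : Prop where
  measurable : Measurable (fun s : Ioi (0 : ℝ) => f s)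
  pos : ∀ x : ℝ, 0 < x → 0 < f x
  tendsto : ∀ l : ℝ, 0 < l → Tendsto (fun x => f (l * x) / f x) (𝓝[>] 0) (𝓝 (l ^ β))

/-- `h ∈ RV_∞(α)`: `h` is measurable and positive on `(0, ∞)`, and
`h (λ t) / h t → λ ^ α` as `t → ∞` for every `λ > 0`. -/
structure RegVaryInfty (h : ℝ → ℝ) (α : ℝ) : Prop where
  measurable : Measurable (fun s : Ioi (0 : ℝ) => h s)
  pos : ∀ t : ℝ, 0 < t → 0 < h t
  tendsto : ∀ l : ℝ, 0 < l → Tendsto (fun t => h (l * t) / h t) atTop (𝓝 (l ^ α))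

/-- `F(x) = ∫ₓ¹ du / f(u)`, used for `x > 0`. -/
noncomputable def bigF (f : ℝ → ℝ) (x : ℝ) : ℝ := ∫ u in x..1, 1 / f u

/-- The inverse of `F : (0, ∞) → ℝ`; it is meaningful on the range of `F` on `(0, ∞)`,
which contains `[0, ∞)` when `F(x) → ∞` as `x → 0⁺`. -/
noncomputable def bigFInv (f : ℝ → ℝ) : ℝ → ℝ := Function.invFunOn (bigF f) (Ioi 0)

/-- `x` is a continuous solution on `[0, ∞)` of
`x'(t) = -f(x(t)) + g(t)` for `t > 0`, `x(0) = ξ`. -/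
structure IsSolution (f g : ℝ → ℝ) (ξ : ℝ) (x : ℝ → ℝ) : Prop where
  continuousOn : ContinuousOn x (Ici 0)
  hasDerivAt : ∀ t : ℝ, 0 < t → HasDerivAt x (-f (x t) + g t) t
  initial : x 0 = ξ

/-- On `(0, ∞)`, `g` is asymptotic at infinity to a (not necessarily strictly)
decreasing function. -/
def AsymptoticToDecreasing (g : ℝ → ℝ) : Prop :=
  ∃ γ : ℝ → ℝ, AntitoneOn γ (Ioi 0) ∧ Tendsto (fun t => g t / γ t) atTop (𝓝 1)

end PerturbedODE

/-!
By Baire's theorem the limits defining regular variation are uniform near `λ = 1`. Hence, for every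
`η > 1` there is `μ < 1` such that `g` varies by at most a factor `η` on `[μ t, t]` for large `t`,
and `f` is increasing near `0` up to a factor `η`. Moreover `F (l z) / F z` is asymptotically at
most `l ^ (1 - β)`, so that `F y ≥ c t` forces `y ≤ C F⁻¹(t)`; the growth of `g / f ∘ F⁻¹` then
gives both `f y < g t` and `y < d t g t`, the latter because `z = O(F z * f z)`.

Therefore `f (x s) ≤ η g s` for some `s ∈ [μ t, t]`: otherwise the derivative `1 - g / f ∘ x` of
`F ∘ x` would be bounded below by a positive constant, so `F (x t) ≥ c t` and `f (x t) < g t`,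
a contradiction. Similarly `g s ≤ η f (x s)` for some `s ∈ [μ t, t]`: otherwise `x'` would exceed
a multiple of `g t`, so `x t ≥ d t g t`, and since `f (x t) < g t` this yields
`F (x t) ≥ c x t / f (x t) ≥ c d t`, contradicting `x t < d t g t`. After the last point of
`[μ t, t]` where such an inequality holds, `x` is monotone in the direction that carries the
inequality over to `t`, up to factors `η`.
-/

namespace PerturbedODE

section Preliminaries

theorem mul_sub_le_sub_of_hasDerivAt {φ φ' : ℝ → ℝ} {a b C : ℝ} (hab : a ≤ b)
    (hφ : ContinuousOn φ (Icc a b)) (hφ' : ∀ s ∈ Ioo a b, HasDerivAt φ (φ' s) s)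
    (hC : ∀ s ∈ Ioo a b, C ≤ φ' s) : C * (b - a) ≤ φ b - φ a := by
  rw [← interior_Icc] at hφ' hC
  exact (convex_Icc a b).mul_sub_le_image_sub_of_le_deriv hφ
    (fun s hs => (hφ' s hs).differentiableAt.differentiableWithinAt)
    (fun s hs => (hφ' s hs).deriv ▸ hC s hs) a (left_mem_Icc.2 hab) b (right_mem_Icc.2 hab) hab

theorem exists_last_le {α δ : Type*} [LinearOrder α] [TopologicalSpace α] [OrderTopology α]
    [CompactIccSpace α] [LinearOrder δ] [TopologicalSpace δ] [OrderClosedTopology δ]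
    {φ ψ : α → δ} {a b : α} (hφ : ContinuousOn φ (Icc a b)) (hψ : ContinuousOn ψ (Icc a b))
    (h : ∃ s ∈ Icc a b, φ s ≤ ψ s) :
    ∃ s ∈ Icc a b, φ s ≤ ψ s ∧ ∀ u ∈ Ioc s b, ψ u < φ u := by
  have hclosed : IsClosed {s ∈ Icc a b | φ s ≤ ψ s} := isClosed_Icc.isClosed_le hφ hψ
  obtain ⟨s, ⟨hs, hle⟩, hmax⟩ :=
    (isCompact_Icc.of_isClosed_subset hclosed (sep_subset _ _)).exists_isGreatest h
  exact ⟨s, hs, hle, fun u hu => not_le.1 fun hu' =>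
    (hmax ⟨⟨hs.1.trans hu.1.le, hu.2⟩, hu'⟩).not_gt hu.1⟩

theorem tendsto_div_nhds_one_of_forall_le_mul {ι : Type*} {l : Filter ι} {u v : ι → ℝ}
    (hv : ∀ᶠ i in l, 0 < v i) (huv : ∀ η > 1, ∀ᶠ i in l, u i ≤ η * v i)
    (hvu : ∀ η > 1, ∀ᶠ i in l, v i ≤ η * u i) : Tendsto (fun i => u i / v i) l (𝓝 1) := by
  refine tendsto_order.2 ⟨fun a ha => ?_, fun a ha => ?_⟩
  · obtain ⟨b, hb, hb1⟩ := exists_between (max_lt ha one_pos)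
    obtain ⟨hab, hb0⟩ := max_lt_iff.1 hb
    filter_upwards [hv, hvu b⁻¹ ((one_lt_inv₀ hb0).2 hb1)] with i hvi hi
    rw [inv_mul_eq_div, le_div_iff₀' hb0] at hi
    exact hab.trans_le ((le_div_iff₀ hvi).2 hi)
  · obtain ⟨b, hb1, hba⟩ := exists_between ha
    filter_upwards [hv, huv b hb1] with i hvi hi
    exact ((div_le_iff₀ hvi).2 hi).trans_lt hba

theorem eventually_forall_Icc_mul {P : ℝ → Prop} (hP : ∀ᶠ s in atTop, P s) {μ : ℝ} (hμ : 0 < μ) :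
    ∀ᶠ t in atTop, ∀ s ∈ Icc (μ * t) t, P s := by
  filter_upwards [(tendsto_id.const_mul_atTop hμ).eventually (eventually_forall_ge_atTop.2 hP)]
    with t ht s hs
  exact ht s hs.1

end Preliminaries

section RegularVariation

theorem exists_eventually_prod_nhds_dist_le {ι X E : Type*} [TopologicalSpace X] [BaireSpace X]
    [Nonempty X] [PseudoMetricSpace E] {l : Filter ι} [l.IsCountablyGenerated] {Φ : ι → X → E}
    {L : X → E} (hΦ : ∀ i, Continuous (Φ i)) (hL : Continuous L)
    (hlim : ∀ u, Tendsto (fun i => Φ i u) l (𝓝 (L u))) {ε : ℝ} (hε : 0 < ε) :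
    ∃ a, ∀ᶠ p in l ×ˢ 𝓝 a, dist (Φ p.1 p.2) (L p.2) ≤ ε := by
  obtain ⟨B, hB⟩ := l.exists_antitone_basis
  let A : ℕ → Set X := fun n => {u | ∀ i ∈ B n, dist (Φ i u) (L u) ≤ ε}
  have hA : ∀ n, IsClosed (A n) := fun n => by
    simp only [A, ofPred_forall]
    exact isClosed_biInter fun i _ => isClosed_le ((hΦ i).dist hL) continuous_const
  have hcover : ⋃ n, A n = univ := eq_univ_of_forall fun u => by
    obtain ⟨n, -, hn⟩ := hB.1.eventually_iff.1
      ((hlim u).eventually (Metric.closedBall_mem_nhds _ hε))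
    exact mem_iUnion.2 ⟨n, fun i hi => hn hi⟩
  obtain ⟨n, a, ha⟩ := nonempty_interior_of_iUnion_of_closed hA hcover
  refine ⟨a, ?_⟩
  filter_upwards [prod_mem_prod (hB.mem n) (mem_interior_iff_mem_nhds.1 ha)] with p hp
  exact hp.2 p.1 hp.1

theorem tendsto_add_sub_prod_nhds_zero {E : Type*} [SeminormedAddCommGroup E] {h L : ℝ → E}
    (hh : Continuous h) (hL : Continuous L)
    (hlim : ∀ u, Tendsto (fun s => h (s + u) - h s) atTop (𝓝 (L u))) :
    Tendsto (fun p : ℝ × ℝ => h (p.1 + p.2) - h p.1) (atTop ×ˢ 𝓝 0) (𝓝 0) := by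
  refine NormedAddGroup.tendsto_nhds_zero.2 fun ε hε => ?_
  have hε3 : 0 < ε / 3 := by positivity
  obtain ⟨a, ha⟩ := exists_eventually_prod_nhds_dist_le
    (Φ := fun s u => h (s + u) - h s) (fun s => by fun_prop) hL hlim hε3
  have hshift : Tendsto (fun s : ℝ => s - a) atTop atTop :=
    tendsto_atTop_add_const_right _ _ tendsto_id
  have hadd : Tendsto (fun v : ℝ => v + a) (𝓝 0) (𝓝 a) := by
    simpa using (tendsto_id (x := 𝓝 (0 : ℝ))).add_const a
  have huniform : ∀ᶠ p : ℝ × ℝ in atTop ×ˢ 𝓝 0,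
      ‖h (p.1 + p.2) - h (p.1 - a) - L (p.2 + a)‖ ≤ ε / 3 := by
    simpa [dist_eq_norm, sub_add_add_cancel] using (hshift.prodMap hadd).eventually ha
  have hpoint : ∀ᶠ s in atTop, ‖L a - (h s - h (s - a))‖ < ε / 3 := by
    simpa [dist_eq_norm'] using ((hlim a).comp hshift).eventually (Metric.ball_mem_nhds _ hε3)
  have hLa : ∀ᶠ v in 𝓝 0, ‖L (v + a) - L a‖ < ε / 3 := by
    simpa [dist_eq_norm] using
      (hL.continuousAt.tendsto.comp hadd).eventually (Metric.ball_mem_nhds _ hε3)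
  filter_upwards [huniform, hpoint.prod_inl _, hLa.prod_inr _] with ⟨s, v⟩ h₁ h₂ h₃
  calc ‖h (s + v) - h s‖ = ‖(h (s + v) - h (s - a) - L (v + a)) + (L a - (h s - h (s - a)))
        + (L (v + a) - L a)‖ := by congr 1; abel
    _ ≤ _ := norm_add₃_le
    _ < ε := by linarith

theorem RegVaryInfty.tendsto_mul_div_prod_nhds_one {k : ℝ → ℝ} {α : ℝ} (hk : RegVaryInfty k α)
    (hkc : ContinuousOn k (Ioi 0)) :
    Tendsto (fun p : ℝ × ℝ => k (p.2 * p.1) / k p.1) (atTop ×ˢ 𝓝 1) (𝓝 1) := by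
  have hpos : ∀ s, 0 < k (Real.exp s) := fun s => hk.pos _ (Real.exp_pos s)
  let h : ℝ → ℝ := fun s => Real.log (k (Real.exp s))
  have hh : Continuous h :=
    (hkc.comp_continuous Real.continuous_exp Real.exp_pos).log fun s => (hpos s).ne'
  have hlim : ∀ u, Tendsto (fun s => h (s + u) - h s) atTop (𝓝 (α * u)) := fun u => by
    have := ((hk.tendsto _ (Real.exp_pos u)).comp Real.tendsto_exp_atTop).log
      (Real.rpow_pos_of_pos (Real.exp_pos u) α).ne'
    rw [Real.log_rpow (Real.exp_pos u), Real.log_exp] at this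
    refine this.congr fun s => ?_
    rw [Function.comp_apply, ← Real.exp_add, add_comm u s, Real.log_div (hpos _).ne' (hpos _).ne']
  have hlog : Tendsto (Prod.map Real.log Real.log) (atTop ×ˢ 𝓝 1) (atTop ×ˢ 𝓝 0) :=
    Real.tendsto_log_atTop.prodMap (by simpa using (Real.continuousAt_log one_ne_zero).tendsto)
  have hexp := (tendsto_add_sub_prod_nhds_zero hh (by fun_prop) hlim).rexp.comp hlog
  rw [Real.exp_zero] at hexp
  refine hexp.congr' ?_
  filter_upwards [(eventually_gt_atTop 0).prod_inl _, (lt_mem_nhds one_pos).prod_inr _]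
    with ⟨t, c⟩ (ht : 0 < t) (hc : 0 < c)
  have hct := hk.pos _ (mul_pos hc ht)
  simp only [h, Function.comp_apply, Prod.map_apply, Real.exp_sub, Real.exp_add, Real.exp_log,
    ht, hc, hct, hk.pos, mul_comm t c]

theorem RegVaryZero.comp_inv {f : ℝ → ℝ} {β : ℝ} (hf : RegVaryZero f β) :
    RegVaryInfty (fun t => f t⁻¹) (-β) where
  measurable := hf.measurable.comp
    ((measurable_subtype_coe.inv).subtype_mk (h := fun s : Ioi (0 : ℝ) => inv_pos.2 s.2))
  pos t ht := hf.pos _ (inv_pos.2 ht)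
  tendsto l hl := by
    have := (hf.tendsto l⁻¹ (inv_pos.2 hl)).comp tendsto_inv_atTop_nhdsGT_zero
    rw [Real.inv_rpow hl.le, ← Real.rpow_neg hl.le] at this
    simpa only [Function.comp_def, mul_inv] using this

theorem RegVaryZero.tendsto_mul_div_prod_nhds_one {f : ℝ → ℝ} {β : ℝ} (hf : RegVaryZero f β)
    (hfc : ContinuousOn f (Ioi 0)) :
    Tendsto (fun p : ℝ × ℝ => f (p.2 * p.1) / f p.1) (𝓝[>] 0 ×ˢ 𝓝 1) (𝓝 1) := by
  have hinv : Tendsto (Prod.map Inv.inv Inv.inv) (𝓝[>] (0 : ℝ) ×ˢ 𝓝 (1 : ℝ)) (atTop ×ˢ 𝓝 1) :=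
    tendsto_inv_nhdsGT_zero.prodMap (by simpa using tendsto_inv₀ (one_ne_zero (α := ℝ)))
  have hcomp : ContinuousOn (fun t => f t⁻¹) (Ioi 0) :=
    hfc.comp (continuousOn_inv₀.mono fun t (ht : 0 < t) => ht.ne')
      fun _ ht => inv_pos.2 (mem_Ioi.1 ht)
  simpa [Function.comp_def, mul_comm] using
    (hf.comp_inv.tendsto_mul_div_prod_nhds_one hcomp).comp hinv

theorem exists_forall_Icc_le_mul {k : ℝ → ℝ} {l : Filter ℝ} (hl : ∀ᶠ t in l, 0 < t)
    (hk : ∀ᶠ t in l, 0 < k t)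
    (hlim : Tendsto (fun p : ℝ × ℝ => k (p.2 * p.1) / k p.1) (l ×ˢ 𝓝 1) (𝓝 1))
    {η : ℝ} (hη : 1 < η) :
    ∃ μ ∈ Ioo (0 : ℝ) 1, ∀ᶠ t in l, ∀ s ∈ Icc (μ * t) t, k s ≤ η * k t ∧ k t ≤ η * k s := by
  have hη0 : 0 < η := one_pos.trans hη
  obtain ⟨P, hP, Q, hQ, hPQ⟩ := eventually_prod_iff.1
    (hlim.eventually (Ioo_mem_nhds (inv_lt_one_of_one_lt₀ hη) hη))
  obtain ⟨μ, hμ1, hμ⟩ :=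
    mem_nhdsLE_iff_exists_Icc_subset.1 (mem_nhdsWithin_of_mem_nhds (hQ.and (lt_mem_nhds one_pos)))
  refine ⟨μ, ⟨(hμ (left_mem_Icc.2 hμ1.le)).2, hμ1⟩, ?_⟩
  filter_upwards [hl, hk, hP] with t ht hkt hPt s hs
  have hmem : s / t ∈ Icc μ 1 := ⟨(le_div_iff₀ ht).2 hs.1, (div_le_one ht).2 hs.2⟩
  have hratio : η⁻¹ < k (s / t * t) / k t ∧ k (s / t * t) / k t < η := hPQ hPt (hμ hmem).1
  rw [div_mul_cancel₀ _ ht.ne', lt_div_iff₀ hkt, div_lt_iff₀ hkt, inv_mul_lt_iff₀ hη0] at hratio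
  exact ⟨hratio.2.le, hratio.1.le⟩

theorem RegVaryZero.exists_forall_le_mul_of_le {f : ℝ → ℝ} {β : ℝ} (hf : RegVaryZero f β)
    (hfc : ContinuousOn f (Ioi 0)) (hβ : 0 < β) {η : ℝ} (hη : 1 < η) :
    ∃ r > 0, ∀ y z, 0 < y → y ≤ z → z < r → f y ≤ η * f z := by
  obtain ⟨μ, ⟨hμ0, hμ1⟩, hnear⟩ := exists_forall_Icc_le_mul
    (l := 𝓝[>] 0) self_mem_nhdsWithin (by filter_upwards [self_mem_nhdsWithin] using hf.pos)
    (hf.tendsto_mul_div_prod_nhds_one hfc) hη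
  have hratio : ∀ᶠ z in 𝓝[>] 0, f (μ * z) / f z < 1 :=
    (hf.tendsto μ hμ0).eventually (gt_mem_nhds (Real.rpow_lt_one hμ0.le hμ1 hβ))
  obtain ⟨r, hr, hsub⟩ := mem_nhdsGT_iff_exists_Ioo_subset.1 (hnear.and hratio)
  refine ⟨r, hr, fun y z hy hyz hzr => ?_⟩
  have hz : 0 < z := hy.trans_le hyz
  obtain ⟨w, hw, hyw, hlast⟩ := exists_last_le (φ := fun _ => f y) continuousOn_const
    (hfc.mono fun u hu => hy.trans_le hu.1) ⟨y, left_mem_Icc.2 hyz, le_rfl⟩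
  have hw0 : 0 < w := hy.trans_le hw.1
  -- Otherwise `w / μ ∈ (w, z]` and `f (w / μ) > f w ≥ f y`, so `w` is not the last such point.
  have hμw : μ * z ≤ w := by
    by_contra! hlt
    have hwz : w / μ ≤ z := ((div_lt_iff₀' hμ0).2 hlt).le
    have hwμ : 0 < w / μ := div_pos hw0 hμ0
    have hlt_y := hlast (w / μ) ⟨(lt_div_iff₀ hμ0).2 (mul_lt_of_lt_one_right hw0 hμ1), hwz⟩
    have hlt_w := (hsub ⟨hwμ, hwz.trans_lt hzr⟩).2
    rw [mul_div_cancel₀ _ hμ0.ne', div_lt_one (hf.pos _ hwμ)] at hlt_w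
    exact (hlt_y.trans_le hyw).not_gt hlt_w
  exact hyw.trans ((hsub ⟨hz, hzr⟩).1 w ⟨hμw, hw.2⟩).1

end RegularVariation

section BigF

variable {f g : ℝ → ℝ} {β : ℝ}

theorem hasDerivAt_bigF (hfc : ContinuousOn f (Ioi 0)) (hpos : ∀ y, 0 < y → 0 < f y) {y : ℝ}
    (hy : 0 < y) : HasDerivAt (bigF f) (-(1 / f y)) y := by
  have hcont : ContinuousOn (fun u => 1 / f u) (Ioi 0) :=
    continuousOn_const.div hfc fun u hu => (hpos u hu).ne'
  exact intervalIntegral.integral_hasDerivAt_left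
    (hcont.mono fun u hu => (lt_min hy one_pos).trans_le hu.1).intervalIntegrable
    (hcont.stronglyMeasurableAtFilter isOpen_Ioi y hy) (hcont.continuousAt (Ioi_mem_nhds hy))

theorem continuousOn_bigF (hfc : ContinuousOn f (Ioi 0)) (hpos : ∀ y, 0 < y → 0 < f y) :
    ContinuousOn (bigF f) (Ioi 0) :=
  HasDerivAt.continuousOn fun _ => hasDerivAt_bigF hfc hpos

theorem bigF_one : bigF f 1 = 0 := intervalIntegral.integral_same

theorem antitoneOn_bigF (hfc : ContinuousOn f (Ioi 0)) (hpos : ∀ y, 0 < y → 0 < f y) :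
    AntitoneOn (bigF f) (Ioi 0) :=
  antitoneOn_of_hasDerivWithinAt_nonpos (convex_Ioi 0) (continuousOn_bigF hfc hpos)
    (fun _ hy => (hasDerivAt_bigF hfc hpos (interior_subset hy)).hasDerivWithinAt)
    fun y hy => neg_nonpos.2 (one_div_pos.2 (hpos y (interior_subset hy))).le

theorem bigF_nonneg (hfc : ContinuousOn f (Ioi 0)) (hpos : ∀ y, 0 < y → 0 < f y) {y : ℝ}
    (hy : 0 < y) (hy1 : y ≤ 1) : 0 ≤ bigF f y :=
  bigF_one.ge.trans (antitoneOn_bigF hfc hpos hy (mem_Ioi.2 one_pos) hy1)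

theorem surjOn_bigF (hfc : ContinuousOn f (Ioi 0)) (hpos : ∀ y, 0 < y → 0 < f y)
    (hF : Tendsto (bigF f) (𝓝[>] 0) atTop) : SurjOn (bigF f) (Ioi 0) (Ici 0) := by
  intro t ht
  obtain ⟨y, hyt, hy0, hy1⟩ := ((hF.eventually_ge_atTop t).and
    (Ioo_mem_nhdsGT (one_pos : (0 : ℝ) < 1))).exists
  have hsub : Icc y 1 ⊆ Ioi 0 := fun u hu => hy0.trans_le hu.1
  obtain ⟨u, hu, hut⟩ := intermediate_value_Icc' hy1.le ((continuousOn_bigF hfc hpos).mono hsub)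
    ⟨bigF_one.trans_le ht, hyt⟩
  exact ⟨u, hsub hu, hut⟩

theorem bigFInv_pos (hfc : ContinuousOn f (Ioi 0)) (hpos : ∀ y, 0 < y → 0 < f y)
    (hF : Tendsto (bigF f) (𝓝[>] 0) atTop) {t : ℝ} (ht : 0 ≤ t) : 0 < bigFInv f t :=
  Function.invFunOn_mem (surjOn_bigF hfc hpos hF ht)

theorem bigF_bigFInv (hfc : ContinuousOn f (Ioi 0)) (hpos : ∀ y, 0 < y → 0 < f y)
    (hF : Tendsto (bigF f) (𝓝[>] 0) atTop) {t : ℝ} (ht : 0 ≤ t) : bigF f (bigFInv f t) = t :=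
  Function.invFunOn_eq (surjOn_bigF hfc hpos hF ht)

theorem tendsto_bigFInv (hfc : ContinuousOn f (Ioi 0)) (hpos : ∀ y, 0 < y → 0 < f y)
    (hF : Tendsto (bigF f) (𝓝[>] 0) atTop) : Tendsto (bigFInv f) atTop (𝓝[>] 0) := by
  refine (nhdsGT_basis 0).tendsto_right_iff.2 fun a ha => ?_
  filter_upwards [eventually_ge_atTop 0, eventually_gt_atTop (bigF f a)] with t ht hta
  have hinv := bigFInv_pos hfc hpos hF ht
  refine ⟨hinv, lt_of_not_ge fun hle => hta.not_ge ?_⟩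
  rw [← bigF_bigFInv hfc hpos hF ht]
  exact antitoneOn_bigF hfc hpos ha hinv hle

theorem RegVaryZero.exists_mul_le_bigF_mul (hf : RegVaryZero f β) (hfc : ContinuousOn f (Ioi 0))
    (hβ : 0 < β) : ∃ c > 0, ∀ᶠ z in 𝓝[>] 0, c * z ≤ bigF f z * f z := by
  obtain ⟨r, hr, hmono⟩ := hf.exists_forall_le_mul_of_le hfc hβ one_lt_two
  have hdouble := (hf.tendsto 2 two_pos).eventually (gt_mem_nhds (lt_add_one _))
  set A : ℝ := 2 ^ β + 1
  have hA : 0 < A := by positivity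
  refine ⟨1 / (2 * A), by positivity, ?_⟩
  filter_upwards [hdouble, Ioo_mem_nhdsGT (show 0 < min (r / 2) (1 / 2) by positivity)]
    with z hz ⟨hz0, hzmin⟩
  obtain ⟨hzr, hz1⟩ := lt_min_iff.1 hzmin
  have hfz := hf.pos z hz0
  have hsub : Icc z (2 * z) ⊆ Ioi 0 := fun s hs => hz0.trans_le hs.1
  have hderiv : ∀ s ∈ Ioo z (2 * z), 1 / (2 * A * f z) ≤ - -(1 / f s) := fun s hs => by
    have hs0 : 0 < s := hz0.trans hs.1
    have hfs : f s ≤ 2 * f (2 * z) := hmono s (2 * z) hs0 hs.2.le (by linarith)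
    rw [neg_neg]
    refine one_div_le_one_div_of_le (hf.pos s hs0) (hfs.trans ?_)
    linarith [(div_lt_iff₀ hfz).1 hz]
  have hgrowth := mul_sub_le_sub_of_hasDerivAt (by linarith : z ≤ 2 * z)
    ((continuousOn_bigF hfc hf.pos).neg.mono hsub)
    (fun s hs => (hasDerivAt_bigF hfc hf.pos (hsub (Ioo_subset_Icc_self hs))).neg) hderiv
  have hnonneg := bigF_nonneg hfc hf.pos (by positivity : 0 < 2 * z) (by linarith)
  calc 1 / (2 * A) * z = 1 / (2 * A * f z) * (2 * z - z) * f z := by field_simp; ring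
    _ ≤ bigF f z * f z := by
      gcongr
      simp only [Pi.neg_apply] at hgrowth
      linarith

theorem RegVaryZero.eventually_bigF_mul_le (hf : RegVaryZero f β) (hfc : ContinuousOn f (Ioi 0))
    (hF : Tendsto (bigF f) (𝓝[>] 0) atTop) {l p : ℝ} (hl : 0 < l) (hp : l ^ (1 - β) < p) :
    ∀ᶠ z in 𝓝[>] 0, bigF f (l * z) ≤ p * bigF f z := by
  obtain ⟨q, hlq, hqp⟩ := exists_between hp
  have hq : 0 < q := (Real.rpow_pos_of_pos hl _).trans hlq
  have hlβ : l / q < l ^ β := by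
    rw [Real.rpow_sub hl, Real.rpow_one, div_lt_iff₀ (by positivity)] at hlq
    rwa [div_lt_iff₀' hq]
  obtain ⟨r, hr, hratio⟩ := mem_nhdsGT_iff_exists_Ioo_subset.1
    ((hf.tendsto l hl).eventually (lt_mem_nhds hlβ))
  have hderiv : ∀ s, 0 < s → HasDerivAt (fun z => bigF f (l * z) - q * bigF f z)
      (q / f s - l / f (l * s)) s := fun s hs => by
    have hlin : HasDerivAt (fun z : ℝ => l * z) l s := by
      simpa using (hasDerivAt_id s).const_mul l
    exact (((hasDerivAt_bigF hfc hf.pos (mul_pos hl hs)).comp s hlin).sub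
      ((hasDerivAt_bigF hfc hf.pos hs).const_mul q)).congr_deriv (by ring)
  have hmono : ∀ z ∈ Ioo 0 r, bigF f (l * z) - q * bigF f z ≤ bigF f (l * r) - q * bigF f r := by
    intro z hz
    have := mul_sub_le_sub_of_hasDerivAt (C := 0) hz.2.le
      (HasDerivAt.continuousOn fun s hs => hderiv s (hz.1.trans_le hs.1))
      (fun s hs => hderiv s (hz.1.trans hs.1)) fun s hs => ?_
    · linarith
    have hs0 : 0 < s := hz.1.trans hs.1
    have hfs := hf.pos s hs0
    have hlt : l / q < f (l * s) / f s := hratio ⟨hs0, hs.2⟩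
    rw [div_lt_div_iff₀ hq hfs] at hlt
    rw [sub_nonneg, div_le_div_iff₀ (hf.pos _ (mul_pos hl hs0)) hfs]
    linarith
  filter_upwards [Ioo_mem_nhdsGT hr,
    hF.eventually_ge_atTop ((bigF f (l * r) - q * bigF f r) / (p - q))] with z hz hzF
  rw [div_le_iff₀ (sub_pos.2 hqp)] at hzF
  linarith [hmono z hz]

theorem RegVaryZero.exists_le_mul_bigFInv (hf : RegVaryZero f β) (hfc : ContinuousOn f (Ioi 0))
    (hβ : 1 < β) (hF : Tendsto (bigF f) (𝓝[>] 0) atTop) {c : ℝ} (hc : 0 < c) :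
    ∃ C > 0, ∀ᶠ t in atTop, ∀ y, c * t ≤ bigF f y → y ≤ C * bigFInv f t := by
  obtain ⟨q, hq, hqc⟩ := exists_between hc
  obtain ⟨C, hCq, hC⟩ := (((tendsto_rpow_neg_atTop (sub_pos.2 hβ)).eventually
    (gt_mem_nhds hq)).and (eventually_gt_atTop 0)).exists
  rw [neg_sub] at hCq
  refine ⟨C, hC, ?_⟩
  filter_upwards [(tendsto_bigFInv hfc hf.pos hF).eventually
    (hf.eventually_bigF_mul_le hfc hF hC hCq), eventually_gt_atTop 0] with t hscale ht y hy
  rw [bigF_bigFInv hfc hf.pos hF ht.le] at hscale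
  by_contra! hlt
  have hCz : 0 < C * bigFInv f t := mul_pos hC (bigFInv_pos hfc hf.pos hF ht.le)
  have hle := antitoneOn_bigF hfc hf.pos hCz (hCz.trans hlt) hlt.le
  exact (mul_lt_mul_of_pos_right hqc ht).not_ge (hy.trans (hle.trans hscale))

theorem RegVaryZero.eventually_lt_of_mul_le_bigF (hf : RegVaryZero f β)
    (hfc : ContinuousOn f (Ioi 0)) (hβ : 1 < β) (hF : Tendsto (bigF f) (𝓝[>] 0) atTop)
    (hgF : Tendsto (fun t => g t / f (bigFInv f t)) atTop atTop) {c : ℝ} (hc : 0 < c) :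
    ∀ᶠ t in atTop, ∀ y, 0 < y → c * t ≤ bigF f y → f y < g t := by
  obtain ⟨C, hC, hle⟩ := hf.exists_le_mul_bigFInv hfc hβ hF hc
  obtain ⟨r, hr, hmono⟩ := hf.exists_forall_le_mul_of_le hfc (one_pos.trans hβ) one_lt_two
  have hinv := tendsto_bigFInv hfc hf.pos hF
  filter_upwards [hle, hgF.eventually_gt_atTop (2 * (C ^ β + 1)),
    hinv.eventually (Ioo_mem_nhdsGT (div_pos hr hC)),
    hinv.eventually ((hf.tendsto C hC).eventually (gt_mem_nhds (lt_add_one _)))]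
    with t hyC hg ⟨hz0, hzr⟩ hCz y hy hty
  have hfz := hf.pos _ hz0
  calc f y ≤ 2 * f (C * bigFInv f t) := hmono y _ hy (hyC y hty) ((lt_div_iff₀' hC).1 hzr)
    _ ≤ 2 * ((C ^ β + 1) * f (bigFInv f t)) := by gcongr; exact ((div_lt_iff₀ hfz).1 hCz).le
    _ = 2 * (C ^ β + 1) * f (bigFInv f t) := (mul_assoc _ _ _).symm
    _ < g t := (lt_div_iff₀ hfz).1 hg

theorem RegVaryZero.eventually_lt_mul_of_mul_le_bigF (hf : RegVaryZero f β)
    (hfc : ContinuousOn f (Ioi 0)) (hβ : 1 < β) (hF : Tendsto (bigF f) (𝓝[>] 0) atTop)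
    (hgF : Tendsto (fun t => g t / f (bigFInv f t)) atTop atTop) {c d : ℝ} (hc : 0 < c)
    (hd : 0 < d) : ∀ᶠ t in atTop, ∀ y, c * t ≤ bigF f y → y < d * t * g t := by
  obtain ⟨C, hC, hle⟩ := hf.exists_le_mul_bigFInv hfc hβ hF hc
  obtain ⟨b, hb, hlow⟩ := hf.exists_mul_le_bigF_mul hfc (one_pos.trans hβ)
  filter_upwards [hle, (tendsto_bigFInv hfc hf.pos hF).eventually hlow, eventually_gt_atTop 0,
    hgF.eventually_gt_atTop (C / (b * d))] with t hyC hz ht hg y hty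
  rw [bigF_bigFInv hfc hf.pos hF ht.le, ← le_div_iff₀' hb] at hz
  rw [lt_div_iff₀ (hf.pos _ (bigFInv_pos hfc hf.pos hF ht.le))] at hg
  calc y ≤ C * bigFInv f t := hyC y hty
    _ ≤ C * (t * f (bigFInv f t) / b) := by gcongr
    _ = d * t * (C / (b * d) * f (bigFInv f t)) := by field_simp
    _ < d * t * g t := by gcongr

end BigF

section Solution

variable {f g x : ℝ → ℝ} {ξ α β : ℝ}

theorem IsSolution.pos (hx : IsSolution f g ξ x) (hf0 : f 0 = 0) (hg : ∀ t, 0 < t → 0 < g t)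
    (hξ : 0 < ξ) {t : ℝ} (ht : 0 ≤ t) : 0 < x t := by
  have hnonneg : ∀ b, 0 < b → 0 ≤ x b := by
    intro b hb
    have hxright : Tendsto x (𝓝[>] 0) (𝓝 ξ) := hx.initial ▸
      ((hx.continuousOn 0 self_mem_Ici).mono Ioi_subset_Ici_self).tendsto
    obtain ⟨a, hxa, ha⟩ := ((hxright.eventually (lt_mem_nhds hξ)).and (Ioo_mem_nhdsGT hb)).exists
    have hpos : ∀ s ∈ Icc a b, 0 < s := fun s hs => ha.1.trans_le hs.1
    have hfence := image_le_of_deriv_right_lt_deriv_boundary' (f := fun s => -x s) (B := fun _ => 0)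
      (f' := fun s => -(-f (x s) + g s)) (B' := fun _ => 0)
      (hx.continuousOn.mono fun s hs => (hpos s hs).le).neg
      (fun s hs => (hx.hasDerivAt s (hpos s (Ico_subset_Icc_self hs))).neg.hasDerivWithinAt)
      (neg_nonpos.2 hxa.le) continuousOn_const (fun s _ => hasDerivWithinAt_const s _ 0)
      fun s hs hxs => by
        rw [neg_eq_zero.1 hxs, hf0, neg_zero, zero_add]
        exact neg_neg_of_pos (hg s (hpos s (Ico_subset_Icc_self hs)))
    exact neg_nonpos.1 (hfence (right_mem_Icc.2 ha.2.le))
  rcases ht.eq_or_lt with rfl | ht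
  · exact hx.initial.symm ▸ hξ
  refine (hnonneg t ht).lt_of_ne fun hxt => (hg t ht).ne' ?_
  have hmin : IsLocalMin x t := by
    filter_upwards [Ioi_mem_nhds ht] with s hs using hxt ▸ hnonneg s hs
  simpa [← hxt, hf0] using hmin.hasDerivAt_eq_zero (hx.hasDerivAt t ht)

theorem hasDerivAt_bigF_comp (hfc : ContinuousOn f (Ioi 0)) (hpos : ∀ y, 0 < y → 0 < f y) {t : ℝ}
    (hx : HasDerivAt x (-f (x t) + g t) t) (hxt : 0 < x t) :
    HasDerivAt (fun s => bigF f (x s)) (1 - g t / f (x t)) t := by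
  have := hpos _ hxt
  refine ((hasDerivAt_bigF hfc hpos hxt).comp t hx).congr_deriv ?_
  field_simp
  ring

theorem eventually_exists_comp_le_mul (hf : RegVaryZero f β) (hfc : ContinuousOn f (Ioi 0))
    (hβ : 1 < β) (hF : Tendsto (bigF f) (𝓝[>] 0) atTop)
    (hgF : Tendsto (fun t => g t / f (bigFInv f t)) atTop atTop)
    (hx : ∀ᶠ t in atTop, HasDerivAt x (-f (x t) + g t) t) (hx0 : Tendsto x atTop (𝓝[>] 0))
    {μ η : ℝ} (hμ : μ ∈ Ioo 0 1) (hη : 1 < η) :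
    ∀ᶠ t in atTop, ∃ s ∈ Icc (μ * t) t, f (x s) ≤ η * g s := by
  have hη0 : 0 < η := one_pos.trans hη
  have hc : 0 < (1 - η⁻¹) * (1 - μ) :=
    mul_pos (sub_pos.2 (inv_lt_one_of_one_lt₀ hη)) (sub_pos.2 hμ.2)
  filter_upwards [eventually_forall_Icc_mul (hx.and (hx0.eventually (Ioo_mem_nhdsGT one_pos))) hμ.1,
    hf.eventually_lt_of_mul_le_bigF hfc hβ hF hgF hc, eventually_gt_atTop 0] with t hode hlt ht
  have hμt : μ * t ≤ t := mul_le_of_le_one_left ht.le hμ.2.le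
  by_contra! hcon
  have hderiv : ∀ s ∈ Icc (μ * t) t,
      HasDerivAt (fun s => bigF f (x s)) (1 - g s / f (x s)) s := fun s hs =>
    hasDerivAt_bigF_comp hfc hf.pos (hode s hs).1 (hode s hs).2.1
  have hgrowth := mul_sub_le_sub_of_hasDerivAt (C := 1 - η⁻¹) hμt (HasDerivAt.continuousOn hderiv)
    (fun s hs => hderiv s (Ioo_subset_Icc_self hs)) fun s hs => by
      have hs := Ioo_subset_Icc_self hs
      gcongr
      rw [div_le_iff₀ (hf.pos _ (hode s hs).2.1), le_inv_mul_iff₀ hη0]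
      exact (hcon s hs).le
  have hl := (hode _ (left_mem_Icc.2 hμt)).2
  have hr := (hode t (right_mem_Icc.2 hμt)).2
  have hfar : (1 - η⁻¹) * (1 - μ) * t ≤ bigF f (x t) := by
    linarith [bigF_nonneg hfc hf.pos hl.1 hl.2.le]
  nlinarith [hlt (x t) hr.1 hfar, hcon t (right_mem_Icc.2 hμt), hf.pos _ hr.1]

theorem eventually_exists_le_mul_comp (hf : RegVaryZero f β) (hfc : ContinuousOn f (Ioi 0))
    (hβ : 1 < β) (hF : Tendsto (bigF f) (𝓝[>] 0) atTop)
    (hgF : Tendsto (fun t => g t / f (bigFInv f t)) atTop atTop)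
    (hx : ∀ᶠ t in atTop, HasDerivAt x (-f (x t) + g t) t) (hx0 : Tendsto x atTop (𝓝[>] 0))
    {μ η A : ℝ} (hμ : μ ∈ Ioo 0 1) (hη : 1 < η) (hA : 0 < A)
    (hg : ∀ᶠ t in atTop, ∀ s ∈ Icc (μ * t) t, g t ≤ A * g s) :
    ∀ᶠ t in atTop, ∃ s ∈ Icc (μ * t) t, g s ≤ η * f (x s) := by
  have hη0 : 0 < η := one_pos.trans hη
  have hη1 : 0 < 1 - η⁻¹ := sub_pos.2 (inv_lt_one_of_one_lt₀ hη)
  obtain ⟨c, hc, hlow⟩ := hf.exists_mul_le_bigF_mul hfc (one_pos.trans hβ)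
  set d := (1 - η⁻¹) / A * (1 - μ) with hd
  have hd0 : 0 < d := mul_pos (div_pos hη1 hA) (sub_pos.2 hμ.2)
  filter_upwards [eventually_forall_Icc_mul (hx.and (hx0.eventually (Ioo_mem_nhdsGT one_pos))) hμ.1,
    hf.eventually_lt_mul_of_mul_le_bigF hfc hβ hF hgF (mul_pos hc hd0) hd0,
    hx0.eventually hlow, hg, eventually_gt_atTop 0] with t hode hlt hlow hg ht
  have hμt : μ * t ≤ t := mul_le_of_le_one_left ht.le hμ.2.le
  by_contra! hcon
  have hgrowth := mul_sub_le_sub_of_hasDerivAt (C := (1 - η⁻¹) / A * g t) hμt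
    (HasDerivAt.continuousOn fun s hs => (hode s hs).1)
    (fun s hs => (hode s (Ioo_subset_Icc_self hs)).1) fun s hs => by
      have hs := Ioo_subset_Icc_self hs
      have hfs : f (x s) ≤ η⁻¹ * g s := (le_inv_mul_iff₀ hη0).2 (hcon s hs).le
      calc (1 - η⁻¹) / A * g t ≤ (1 - η⁻¹) / A * (A * g s) := by gcongr; exact hg s hs
        _ = (1 - η⁻¹) * g s := by field_simp
        _ ≤ -f (x s) + g s := by linarith
  have hl := (hode _ (left_mem_Icc.2 hμt)).2
  have hr := (hode t (right_mem_Icc.2 hμt)).2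
  have hxt : d * t * g t ≤ x t := by
    rw [hd]
    linarith [hl.1]
  have hfg : f (x t) ≤ g t := by
    nlinarith [hcon t (right_mem_Icc.2 hμt), hf.pos _ hr.1]
  have hgt : 0 < g t := (hf.pos _ hr.1).trans_le hfg
  have hfar : c * d * t ≤ bigF f (x t) := by
    refine le_of_mul_le_mul_right ?_ hgt
    calc c * d * t * g t = c * (d * t * g t) := by ring
      _ ≤ c * x t := by gcongr
      _ ≤ bigF f (x t) * f (x t) := hlow
      _ ≤ bigF f (x t) * g t := by gcongr; exact bigF_nonneg hfc hf.pos hr.1 hr.2.le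
  exact (hlt (x t) hfar).not_ge hxt

theorem eventually_comp_le_pow_mul (hf : RegVaryZero f β) (hfc : ContinuousOn f (Ioi 0))
    (hβ : 1 < β) (hF : Tendsto (bigF f) (𝓝[>] 0) atTop) (hg : RegVaryInfty g α)
    (hgc : ContinuousOn g (Ioi 0))
    (hgF : Tendsto (fun t => g t / f (bigFInv f t)) atTop atTop)
    (hx : ∀ᶠ t in atTop, HasDerivAt x (-f (x t) + g t) t) (hx0 : Tendsto x atTop (𝓝[>] 0))
    {η : ℝ} (hη : 1 < η) : ∀ᶠ t in atTop, f (x t) ≤ η ^ 3 * g t := by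
  have : 0 < η := one_pos.trans hη
  obtain ⟨μ, hμ, hgμ⟩ := exists_forall_Icc_le_mul (eventually_gt_atTop 0)
    ((eventually_gt_atTop 0).mono hg.pos) (hg.tendsto_mul_div_prod_nhds_one hgc) hη
  obtain ⟨r, hr, hmono⟩ := hf.exists_forall_le_mul_of_le hfc (one_pos.trans hβ) hη
  filter_upwards [eventually_exists_comp_le_mul hf hfc hβ hF hgF hx hx0 hμ hη, hgμ,
    eventually_forall_Icc_mul (hx.and (hx0.eventually (Ioo_mem_nhdsGT hr))) hμ.1,
    eventually_gt_atTop 0] with t hex hgt hode ht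
  have hpos : ∀ s ∈ Icc (μ * t) t, 0 < s := fun s hs => (mul_pos hμ.1 ht).trans_le hs.1
  have hxc : ContinuousOn x (Icc (μ * t) t) := HasDerivAt.continuousOn fun s hs => (hode s hs).1
  obtain ⟨s, hs, hfs, hlast⟩ := exists_last_le (φ := fun s => f (x s)) (ψ := fun s => η * g s)
    (hfc.comp hxc fun s hs => (hode s hs).2.1) (continuousOn_const.mul (hgc.mono hpos)) hex
  have hsub : Icc s t ⊆ Icc (μ * t) t := Icc_subset_Icc_left hs.1
  have hdecr : x t ≤ x s := by
    have := mul_sub_le_sub_of_hasDerivAt (C := 0) hs.2 (hxc.neg.mono hsub)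
      (fun u hu => (hode u (hsub (Ioo_subset_Icc_self hu))).1.neg) fun u hu => by
        have hgu := hg.pos u (hpos u (hsub (Ioo_subset_Icc_self hu)))
        linarith [hlast u (Ioo_subset_Ioc_self hu), lt_mul_of_one_lt_left hgu hη]
    simp only [Pi.neg_apply] at this
    linarith
  calc f (x t) ≤ η * f (x s) :=
        hmono _ _ (hode t (hsub (right_mem_Icc.2 hs.2))).2.1 hdecr (hode s hs).2.2
    _ ≤ η * (η * g s) := by gcongr
    _ ≤ η * (η * (η * g t)) := by gcongr; exact (hgt s hs).1
    _ = η ^ 3 * g t := by ring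

theorem eventually_le_pow_mul_comp (hf : RegVaryZero f β) (hfc : ContinuousOn f (Ioi 0))
    (hβ : 1 < β) (hF : Tendsto (bigF f) (𝓝[>] 0) atTop) (hg : RegVaryInfty g α)
    (hgc : ContinuousOn g (Ioi 0))
    (hgF : Tendsto (fun t => g t / f (bigFInv f t)) atTop atTop)
    (hx : ∀ᶠ t in atTop, HasDerivAt x (-f (x t) + g t) t) (hx0 : Tendsto x atTop (𝓝[>] 0))
    {η : ℝ} (hη : 1 < η) : ∀ᶠ t in atTop, g t ≤ η ^ 3 * f (x t) := by
  have hη0 : 0 < η := one_pos.trans hη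
  obtain ⟨μ, hμ, hgμ⟩ := exists_forall_Icc_le_mul (eventually_gt_atTop 0)
    ((eventually_gt_atTop 0).mono hg.pos) (hg.tendsto_mul_div_prod_nhds_one hgc) hη
  obtain ⟨r, hr, hmono⟩ := hf.exists_forall_le_mul_of_le hfc (one_pos.trans hβ) hη
  filter_upwards [eventually_exists_le_mul_comp hf hfc hβ hF hgF hx hx0 hμ hη hη0
      (hgμ.mono fun t ht s hs => (ht s hs).2), hgμ,
    eventually_forall_Icc_mul (hx.and (hx0.eventually (Ioo_mem_nhdsGT hr))) hμ.1,
    eventually_gt_atTop 0] with t hex hgt hode ht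
  have hpos : ∀ s ∈ Icc (μ * t) t, 0 < s := fun s hs => (mul_pos hμ.1 ht).trans_le hs.1
  have hxc : ContinuousOn x (Icc (μ * t) t) := HasDerivAt.continuousOn fun s hs => (hode s hs).1
  obtain ⟨s, hs, hgs, hlast⟩ := exists_last_le (φ := g) (ψ := fun s => η * f (x s))
    (hgc.mono hpos) (continuousOn_const.mul (hfc.comp hxc fun s hs => (hode s hs).2.1)) hex
  have hsub : Icc s t ⊆ Icc (μ * t) t := Icc_subset_Icc_left hs.1
  have hincr : x s ≤ x t := by
    have := mul_sub_le_sub_of_hasDerivAt (C := 0) hs.2 (hxc.mono hsub)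
      (fun u hu => (hode u (hsub (Ioo_subset_Icc_self hu))).1) fun u hu => by
        have hfu := hf.pos _ (hode u (hsub (Ioo_subset_Icc_self hu))).2.1
        linarith [hlast u (Ioo_subset_Ioc_self hu), lt_mul_of_one_lt_left hfu hη]
    linarith
  calc g t ≤ η * g s := (hgt s hs).2
    _ ≤ η * (η * f (x s)) := by gcongr
    _ ≤ η * (η * (η * f (x t))) := by
      gcongr
      exact hmono _ _ (hode s hs).2.1 hincr (hode t (hsub (right_mem_Icc.2 hs.2))).2.2
    _ = η ^ 3 * f (x t) := by ring

end Solution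

end PerturbedODE

theorem mainTheorem4_general {f g x : ℝ → ℝ} {α β : ℝ} (hfc : ContinuousOn f (Ioi 0))
    (hf : PerturbedODE.RegVaryZero f β) (hβ : 1 < β)
    (hF : Tendsto (PerturbedODE.bigF f) (𝓝[>] 0) atTop)
    (hgc : ContinuousOn g (Ioi 0)) (hg : PerturbedODE.RegVaryInfty g α)
    (hgF : Tendsto (fun t => g t / f (PerturbedODE.bigFInv f t)) atTop atTop)
    (hx : ∀ᶠ t in atTop, HasDerivAt x (-f (x t) + g t) t) (hx0 : Tendsto x atTop (𝓝[>] 0)) :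
    Tendsto (fun t => f (x t) / g t) atTop (𝓝 1) := by
  have hroot : ∀ η : ℝ, 1 < η → ∃ ρ, 1 < ρ ∧ ρ ^ 3 = η := fun η hη =>
    ⟨η ^ ((3 : ℕ) : ℝ)⁻¹, Real.one_lt_rpow hη (by positivity),
      Real.rpow_inv_natCast_pow (one_pos.trans hη).le three_ne_zero⟩
  refine PerturbedODE.tendsto_div_nhds_one_of_forall_le_mul
    ((eventually_gt_atTop 0).mono hg.pos) (fun η hη => ?_) (fun η hη => ?_) <;>
  obtain ⟨ρ, hρ, rfl⟩ := hroot η hη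
  · exact PerturbedODE.eventually_comp_le_pow_mul hf hfc hβ hF hg hgc hgF hx hx0 hρ
  · exact PerturbedODE.eventually_le_pow_mul_comp hf hfc hβ hF hg hgc hgF hx hx0 hρ

theorem mainTheorem4 (f g x : ℝ → ℝ) (ξ β θ : ℝ)
    (hf_stable : (∀ y : ℝ, y ≠ 0 → 0 < y * f y) ∧ f 0 = 0)
    (hf_lip : LocallyLipschitz f)
    (hF : Tendsto (PerturbedODE.bigF f) (𝓝[>] 0) atTop)
    (hf_cont : Continuous f) (hg_cont : ContinuousOn g (Ici 0))
    (hg_pos : ∀ t : ℝ, 0 < t → 0 < g t) (hξ : 0 < ξ)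
    (hgF : Tendsto (fun t => g t / f (PerturbedODE.bigFInv f t)) atTop atTop)
    (hβ : 1 < β) (hf_rv : PerturbedODE.RegVaryZero f β)
    (hθ : 0 ≤ θ) (hg_rv : PerturbedODE.RegVaryInfty g (-θ))
    (hx : PerturbedODE.IsSolution f g ξ x)
    (hx_lim : Tendsto x atTop (𝓝 0)) :
    (0 < θ → Tendsto (fun t => f (x t) / g t) atTop (𝓝 1)) ∧
    (θ = 0 → PerturbedODE.AsymptoticToDecreasing g →
      Tendsto (fun t => f (x t) / g t) atTop (𝓝 1)) := by
  have hx0 : Tendsto x atTop (𝓝[>] 0) := tendsto_nhdsWithin_iff.2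
    ⟨hx_lim, (eventually_ge_atTop 0).mono fun _ => hx.pos hf_stable.2 hg_pos hξ⟩
  have h := mainTheorem4_general hf_cont.continuousOn hf_rv hβ hF
    (hg_cont.mono Ioi_subset_Ici_self) hg_rv hgF ((eventually_gt_atTop 0).mono hx.hasDerivAt) hx0
  exact ⟨fun _ => h, fun _ _ => h⟩
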